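/- **Setting.** Let $P=\{1,\dots,n\}$ be a set of parties, $T\in\mathbb N$, $c\in\mathbb R^{T+1}$, $Z\in\mathbb R^{(T+1)\times T}$ (rows indexed by $0,\dots,T$) a *valid Gaussian*: $\sum_{t=0}^T\big(c_tu+\sum_kZ_{t,k}g_k\big)=u$ for all $u\in\mathbb R$, $g\in\mathbb R^T$; the $(T+1)\times(T+1)$ matrix $(c,Z)$ is invertible; and the first $T$ rows of $Z$ form an invertible matrix. For $t\in\{1,\dots,T\}$ let $E_t\subseteq P\times P$ be the set of pairs $(i,j)$ such that $i$ is to send its message to $j$ at iteration $t$, let $N_{i,t}=\{j:(i,j)\in E_t\}$, and let $W_t\in\mathbb R^{n\times n}$ be column stochastic ($\sum_iW_{t;i,j}=1$ for all $j$) with $W_{t;i,j}\ne0$ only if $i=j$ or $(j,i)\in E_t$. Let $O_t\subseteq P$ be the set of parties that are online at iteration $t$ ($O_0=P$). For $i\in P$ and $t\in\{0,\dots,T\}$ put $r_i(t)=|\{1\le s\le t:i\in O_s\}|$. If $i\notin O_t$ let $c^O_{i,t}=0$, $Z^O_{i;t,:}=0$. If $i\in O_t$ let $c^O_{i,t}=c_{r_i(t)}$,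 and $Z^O_{i;t,:}=Z_{r_i(t),:}$ for $t<T$, while $Z^O_{i;T,:}=-\sum_{s<r_i(T)}Z_{s,:}$. For $t\geq 1$ and $i\in O_t$ let $W^O_{t;i,i}=W_{t;i,i}+\sum_{k\notin O_t}W_{t;k,i}$, and for $j\neq i$ let $W^O_{t;i,j}=W_{t;i,j}$ if $j\in O_t$ and $W^O_{t;i,j}=0$ otherwise; for $i\notin O_t$ the $i$-th row of $W^O_t$ is that of the identity matrix. On private values $x\in[0,1]^n$, the protocol draws independent noise $\eta^{\rm ind}_i\sim\mathcal N(0,\sigma_{\rm ind}^2)$ and $\eta_{i,k}\sim\mathcal N(0,\sigma_\Delta^2)$ ($i\in P$, $1\le k\le T$) and computes, with $v_i^{(t)}=c^O_{i,t}(x_i+\eta^{\rm ind}_i)+\sum_kZ^O_{i;t,k}\eta_{i,k}$, the messages $y^{(0)}_i=v^{(0)}_i$ and, for $t\ge1$, $y^{(t)}_i=\sum_jW^O_{t;i,j}y^{(t-1)}_j+v^{(t)}_i$ if $i\in O_t$, $y^{(t)}_i=y^{(t-1)}_i$ if $i\notin O_t$. **Adversary.** The adversary knows all of the above except $x$ and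 the noise, and observes $y_i^{(t)}$ for $(i,t)$ in a set $\mathcal V$. Let $C\subseteq P$ be the set of corrupted parties, $H=P\setminus C$ and $n_H=|H|$. Either (E) $C=\emptyset$ and $\mathcal V\supseteq P\times\{T\}$, or (C) $\mathcal V=\{(i,t):t<T,\ (\{i\}\cup N_{i,t+1})\cap C\neq\emptyset\}\cup(P\times\{T\})$. Two datasets $x,x'\in[0,1]^n$ are neighboring if they differ at most in the value of one honest party. The execution is $(\varepsilon,\delta)$-E-DP, respectively $(\varepsilon,\delta)$-C-DP, if $\Pr(A(x)\in S)\le e^\varepsilon\Pr(A(x')\in S)+\delta$ for all neighboring $x,x'$ and all measurable $S$, where $A(x)$ consists of the observed messages in case (E), and of the observed messages and all noise terms of the corrupted parties in case (C). **Theorem.** Let $w_i=\sum_tc^O_{i,t}$ and $w_O=\sum_{i\in H}w_i$. Assume $n_H\ge2$, $0<w_i\le1$ for all $i\in H$, and $w_O\ne1$. Let $\mathcal H$ be the set of $(i,t)$, $i\in H$, such that the message $y_i^{(t)}$ is not seen by the adversary, i.e. $(i,t)\notin\mathcal V$, and $(i,s)\notin\mathcal V$ for every $s<t$ such that $i$ is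 offline during all of $s+1,\dots,t$ (so that $y_i^{(s)}$ and $y_i^{(t)}$ are the same message). For $(i,t)\in\mathcal H$ (hence $t<T$) let $e^{(i,t)}\in\mathbb R^n$ be given by $e^{(i,t)}_i=(W^O_{t+1;i,i}-1)/w_i$, $e^{(i,t)}_j=W^O_{t+1;j,i}/w_j$ for $j\in H\setminus\{i\}$, and $e^{(i,t)}_j=0$ for $j\in C$. Suppose that $\{e^{(i,t)}\}_{(i,t)\in\mathcal H}$ contains at least $n_H-1$ linearly independent vectors. Then there are, for all neighboring $x,x'$, changes $\theta=\theta(x,x')\in\mathbb R^n$ and $\Delta=\Delta(x,x')\in\mathbb R^{n\times T}$ of the noise, zero at corrupted parties, such that for all values of the noise the observed messages on $(x,\eta^{\rm ind},\eta)$ are the same as those on $(x',\eta^{\rm ind}+\theta,\eta+\Delta)$, such that $\|\Delta(x,x')\|_2^2$ is bounded over all neighboring $x,x'$, and such that the following holds. For all $\varepsilon,\delta\in(0,1)$, all real $\kappa$ with $\kappa^2>2\ln(1.25/\delta)$, and all $$\sigma_{\rm ind}^2>\frac{(n_H-1)\kappa^2}{(w_O-1)^2\varepsilon^2},\qquad \sigma_\Delta^2>0\quad\text{with}\quad\sigma_\Delta^2\ge\frac{\|\Delta(x,x')\|_2^2}{\frac{\varepsilon^2}{\kappa^2}-\frac{n_H-1}{(w_O-1)^2\sigma_{\rm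 ind}^2}}\ \text{ for all neighboring }x,x',$$ the execution is $(\varepsilon,\delta)$-E-DP in case (E) and $(\varepsilon,\delta)$-C-DP in case (C). -/

import Mathlib

open MeasureTheory ProbabilityTheory
open scoped NNReal ENNReal

noncomputable section

namespace IncA

/-- A `(c, Z)`-Gaussian sends a value `u` and noise terms `g k` to the increments
`v t = c t * u + ∑ k, Z t k * g k`. It is valid if (i) the increments always sum to `u`,
(ii) the square matrix `(c, Z)` is invertible, (iii) `Z` without its last row is invertible. -/
structure IsValidGaussian {T : ℕ} (c : Fin (T + 1) → ℝ) (Z : Matrix (Fin (T + 1)) (Fin T) ℝ) :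
    Prop where
  sum_eq : ∀ (u : ℝ) (g : Fin T → ℝ), ∑ t, (c t * u + ∑ k, Z t k * g k) = u
  isUnit_full : IsUnit
    (Matrix.of fun t => Fin.cons (c t) (Z t) : Matrix (Fin (T + 1)) (Fin (T + 1)) ℝ)
  isUnit_init : IsUnit (Matrix.of fun t k => Z t.castSucc k : Matrix (Fin T) (Fin T) ℝ)

/-- The public data of an execution, with dropouts, of the incremental averaging protocol on the
parties `Fin n` with `T` mixing iterations, and of the adversary that attacks it.
`weight t`, `edges t` (for `t : Fin T`) belong to iteration `t + 1`. -/
structure Execution (n T : ℕ) where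
  /-- injection coefficients of the private value -/
  c : Fin (T + 1) → ℝ
  /-- injection coefficients of the canceling noise terms -/
  Z : Matrix (Fin (T + 1)) (Fin T) ℝ
  /-- `(i, j) ∈ edges t`: party `i` is to send its message to `j` -/
  edges : Fin T → Set (Fin n × Fin n)
  /-- `weight t i j` is the weight with which `i` aggregates the message of `j` -/
  weight : Fin T → Matrix (Fin n) (Fin n) ℝ
  weight_support : ∀ t i j, weight t i j ≠ 0 → i = j ∨ (j, i) ∈ edges t
  /-- the parties that did not drop out at an iteration -/
  online : Fin (T + 1) → Finset (Fin n)
  online_zero : online 0 = Finset.univ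
  /-- the parties controlled by the adversary -/
  corrupted : Finset (Fin n)
  /-- `(i, t) ∈ observed`: the adversary observes the message `y i t` -/
  observed : Finset (Fin n × Fin (T + 1))

namespace Execution

variable {n T : ℕ} (E : Execution n T)

/-- Column stochasticity of all weight matrices. -/
def ColumnStochastic : Prop := ∀ t j, ∑ i, E.weight t i j = 1

/-- The number of iterations in `[1, t]` at which party `i` is online. -/
def onlineCount (i : Fin n) (t : Fin (T + 1)) : ℕ :=
  (Finset.univ.filter fun s : Fin (T + 1) => 0 < s ∧ s ≤ t ∧ i ∈ E.online s).card

theorem onlineCount_lt (i : Fin n) (t : Fin (T + 1)) : E.onlineCount i t < T + 1 := by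
  have h : (Finset.univ.filter fun s : Fin (T + 1) => 0 < s ∧ s ≤ t ∧ i ∈ E.online s) ⊂
      Finset.univ := by
    refine Finset.ssubset_univ_iff.2 fun h => ?_
    have := h.symm ▸ Finset.mem_univ (0 : Fin (T + 1))
    simp at this
  simpa [onlineCount] using Finset.card_lt_card h

/-- The row of `(c, Z)` that party `i` uses at iteration `t`, if it is online. -/
def row (i : Fin n) (t : Fin (T + 1)) : Fin (T + 1) := ⟨E.onlineCount i t, E.onlineCount_lt i t⟩

/-- The coefficient with which party `i` injects its (noisy) value at iteration `t`. -/
def cOn (i : Fin n) (t : Fin (T + 1)) : ℝ :=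
  if i ∈ E.online t then E.c (E.row i t) else 0

/-- The coefficients with which party `i` injects its canceling noise terms at iteration `t`.
A party that is online at the last iteration then cancels all that it injected before. -/
def ZOn (i : Fin n) (t : Fin (T + 1)) (k : Fin T) : ℝ :=
  if i ∈ E.online t then
    if t = Fin.last T then - ∑ s ∈ Finset.univ.filter (fun s => s < E.row i t), E.Z s k
    else E.Z (E.row i t) k
  else 0

/-- The weight matrix that is really used at iteration `t + 1`, given the dropouts: weights of
messages from or to absent parties are removed, and a party adds to the weight of its own message
the weights of the messages which it could not deliver. Absent parties keep their message. -/
def weightOn (t : Fin T) : Matrix (Fin n) (Fin n) ℝ := Matrix.of fun i j =>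
  if i ∈ E.online t.succ then
    if i = j then E.weight t i i + ∑ k ∈ (E.online t.succ)ᶜ, E.weight t k i
    else if j ∈ E.online t.succ then E.weight t i j else 0
  else if i = j then 1 else 0

/-- What party `i` injects at iteration `t`, from its noisy value `u i` and canceling noise. -/
def inject (u : Fin n → ℝ) (g : Fin n → Fin T → ℝ) (i : Fin n) (t : Fin (T + 1)) : ℝ :=
  E.cOn i t * u i + ∑ k, E.ZOn i t k * g i k

/-- The messages `y t i` of the protocol, on noisy values `u` and canceling noise terms `g`. -/
def message (u : Fin n → ℝ) (g : Fin n → Fin T → ℝ) : Fin (T + 1) → Fin n → ℝ :=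
  Fin.induction (motive := fun _ => Fin n → ℝ) (fun i => E.inject u g i 0)
    (fun t y i =>
      if i ∈ E.online t.succ then ∑ j, E.weightOn t i j * y j + E.inject u g i t.succ
      else y i)

/-- The messages that the adversary observes. -/
def view (u : Fin n → ℝ) (g : Fin n → Fin T → ℝ) : E.observed → ℝ :=
  fun p => E.message u g p.1.2 p.1.1

/-- The view of colluding parties: the observed messages and all noise of corrupted parties. -/
def collusionView (x : Fin n → ℝ) (ω : (Fin n → ℝ) × (Fin n → Fin T → ℝ)) :
    (E.observed → ℝ) × (E.corrupted → ℝ) × (E.corrupted → Fin T → ℝ) :=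
  (E.view (x + ω.1) ω.2, fun i => ω.1 i, fun i => ω.2 i)

/-- The eavesdropping adversary corrupts nobody and observes at least all final messages. -/
def Eavesdropping : Prop := E.corrupted = ∅ ∧ ∀ i, (i, Fin.last T) ∈ E.observed

/-- The colluding adversary observes all final messages, and an earlier message exactly if its
sender is corrupted or it is to be sent to a corrupted party. -/
def Collusion : Prop := ∀ i t, (i, t) ∈ E.observed ↔
  t = Fin.last T ∨ ∃ s : Fin T, t = s.castSucc ∧ ∃ j ∈ E.corrupted, j = i ∨ (i, j) ∈ E.edges s

/-- The number of honest parties. -/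
def numHonest : ℕ := (E.corrupted)ᶜ.card

/-- The proportion of its private value that party `i` injects. -/
def totalWeight (i : Fin n) : ℝ := ∑ t, E.cOn i t

/-- The total weight that honest parties inject. -/
def honestWeight : ℝ := ∑ i ∈ (E.corrupted)ᶜ, E.totalWeight i

/-- The message `y i t` of the honest party `i` is not seen by the adversary. While a party is
absent it keeps its message, so this message may also have been seen at an earlier iteration
`s ≤ t`, if the party was absent during `[s + 1, t]`. -/
def Unseen (i : Fin n) (t : Fin (T + 1)) : Prop :=
  i ∉ E.corrupted ∧ ∀ s ≤ t, (∀ r, s < r → r ≤ t → i ∉ E.online r) → (i, s) ∉ E.observed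

/-- The vector `e^(i,t)`, with zeros at corrupted parties. -/
def edgeVec (i : Fin n) (t : Fin T) (j : Fin n) : ℝ :=
  if j ∈ E.corrupted then 0
  else if j = i then (E.weightOn t i i - 1) / E.totalWeight i
  else E.weightOn t j i / E.totalWeight j

/-- The vectors `e^(i,t)` of the unseen messages. Final messages are always observed, so `t < T`. -/
def edgeVecs : Set (Fin n → ℝ) := {v | ∃ i t, E.Unseen i t.castSucc ∧ v = E.edgeVec i t}

/-- Private values in `[0, 1]` which differ at most in the value of one honest party. -/
def Neighboring (x x' : Fin n → ℝ) : Prop :=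
  (∀ j, x j ∈ Set.Icc (0 : ℝ) 1) ∧ (∀ j, x' j ∈ Set.Icc (0 : ℝ) 1) ∧
    ∃ i ∉ E.corrupted, ∀ j, j ≠ i → x j = x' j

/-- The changes `θ` and `Δ` of the noise of honest parties hide from the adversary that the private
values are `x'` rather than `x`. -/
def Hides (x x' : Fin n → ℝ) (θ : Fin n → ℝ) (Δ : Fin n → Fin T → ℝ) : Prop :=
  (∀ i ∈ E.corrupted, θ i = 0 ∧ Δ i = 0) ∧
    ∀ η g, E.view (x + η) g = E.view (x' + η + θ) (g + Δ)

end Execution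

/-- `(ε, δ)`-differential privacy of a randomized algorithm, given by its output distributions. -/
def IsDP {X Y : Type*} [MeasurableSpace Y] (neighboring : X → X → Prop) (ε δ : ℝ)
    (A : X → Measure Y) : Prop :=
  ∀ x x', neighboring x x' → ∀ S, MeasurableSet S →
    A x S ≤ ENNReal.ofReal (Real.exp ε) * A x' S + ENNReal.ofReal δ

/-- The law of all independent noise terms (variance `vInd`) and canceling noise terms
(variance `vCan`), which are jointly independent. -/
def noiseLaw (n T : ℕ) (vInd vCan : ℝ≥0) : Measure ((Fin n → ℝ) × (Fin n → Fin T → ℝ)) :=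
  (Measure.pi fun _ => gaussianReal 0 vInd).prod
    (Measure.pi fun _ => Measure.pi fun _ => gaussianReal 0 vCan)

namespace Execution

variable {n T : ℕ} (E : Execution n T)

theorem measurable_collusionView (x : Fin n → ℝ) : Measurable (E.collusionView x) := by
  have key : ∀ (t : Fin (T + 1)) (i : Fin n), Measurable
      fun ω : (Fin n → ℝ) × (Fin n → Fin T → ℝ) => E.message (x + ω.1) ω.2 t i := by
    intro t
    induction t using Fin.induction with
    | zero =>
      intro i
      simp only [message, Fin.induction_zero, inject, Pi.add_apply]
      fun_prop
    | succ t ih =>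
      intro i
      simp only [message, Fin.induction_succ] at ih ⊢
      by_cases h : i ∈ E.online t.succ
      · simp only [h, if_true]
        refine Measurable.add ?_ ?_
        · exact Finset.measurable_fun_sum _ fun j _ => (ih j).const_mul _
        · simp only [inject, Pi.add_apply]
          fun_prop
      · simpa only [h, if_false] using ih i
  unfold collusionView view
  refine Measurable.prodMk (measurable_pi_lambda _ fun p => key _ _) ?_
  fun_prop

theorem measurable_view (x : Fin n → ℝ) :
    Measurable fun ω : (Fin n → ℝ) × (Fin n → Fin T → ℝ) => E.view (x + ω.1) ω.2 :=
  (E.measurable_collusionView x).fst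

/-- Eavesdrop differential privacy of the execution. -/
def EavesdropDP (ε δ : ℝ) (vInd vCan : ℝ≥0) : Prop :=
  IsDP E.Neighboring ε δ fun x =>
    (noiseLaw n T vInd vCan).map fun ω => E.view (x + ω.1) ω.2

/-- Collusion differential privacy of the execution, for all private values of the corrupted
parties. -/
def CollusionDP (ε δ : ℝ) (vInd vCan : ℝ≥0) : Prop :=
  IsDP E.Neighboring ε δ fun x => (noiseLaw n T vInd vCan).map (E.collusionView x)

end Execution

end IncA

end

/-!
The protocol is linear, so the adversary's view on `x` agrees with its view on `x'` after a
change `(θ, Δ)` of the noise exactly if `a = x' - x + θ` and `Δ` together do not change any observed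
message. Call such an `a` hidden (by some `Δ`).

Which `a` are hidden? Since the first `T` rows of `Z` are invertible, the injections that a party
makes before the last iteration can be prescribed freely by the choice of its canceling noise. A
party that is online at the end then injects what is missing from `w i * a i`
(`Execution.exists_inject_eq`). So a change of the messages can be produced as soon as, for
every party, the injections that it requires have this sum. Changing one unseen message of the
honest party `i`, during the whole time it is held, requires injections whose sums are given by
`E.edgeVec i t`: it is hidden (`Execution.edgeVec_mem_hiddenChanges`). By column
stochasticity all `E.edgeVec i t` lie in the hyperplane `∑ i, w i * a i = 0` of the vectors that
are zero at corrupted parties, and if `n_H - 1` of them are independent, they span it. Hence every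
such `a` is hidden (`Execution.balancedChanges_le_hiddenChanges`).

It remains to choose `θ` of small norm such that `x' - x + θ` lies in the hyperplane. Let `x` and
`x'` differ at `i₀`. If `w_O > 1`, the weight at `i₀` is spread evenly over the other honest parties; if
`w_O < 1`, then `θ = x - x'` is good enough. In both cases
`‖θ‖ ^ 2 ≤ (n_H - 1) / (w_O - 1) ^ 2` (`Execution.exists_balanced_shift`). As `(θ, Δ)` can be taken
proportional to `x i₀ - x' i₀`, it is bounded.

Finally, the outputs on `x` and `x'` have the laws of the same function of the noise and of its
translate by `(θ, Δ)`. In units of standard deviations the squared norm of this translation is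
`‖θ‖ ^ 2 / σ_ind ^ 2 + ‖Δ‖ ^ 2 / σ_Δ ^ 2 ≤ (ε / κ) ^ 2`, which the Gaussian mechanism hides up to
`(ε, δ)` (`IsGaussianShift.measure_le`).
-/

namespace IncA

/-! ### Shifts of Gaussian measures -/

/-- The measure `μ` behaves like a Gaussian measure under translation by `s`: the translate of `μ`
has the density `x ↦ exp (ℓ x - q / 2)` with respect to `μ`, and the log-density `ℓ` is additive
along `s` and, under `μ`, a centered normal random variable of variance `q`. Here `q` is the squared
norm of `s`, measured in units of standard deviations. -/
structure IsGaussianShift {α : Type*} [MeasurableSpace α] [Add α] (μ : Measure α) (s : α)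
    (ℓ : α → ℝ) (q : ℝ≥0) : Prop where
  measurable_logDensity : Measurable ℓ
  logDensity_add : ∀ x, ℓ (x + s) = ℓ x + q
  map_logDensity : μ.map ℓ = gaussianReal 0 q
  lintegral_add : ∀ f : α → ℝ≥0∞, Measurable f →
    ∫⁻ x, f (x + s) ∂μ = ∫⁻ x, ENNReal.ofReal (Real.exp (ℓ x - q / 2)) * f x ∂μ

theorem isGaussianShift_gaussianReal {v : ℝ≥0} (hv : v ≠ 0) (s : ℝ) :
    IsGaussianShift (gaussianReal 0 v) s (fun x => s / v * x) (Real.toNNReal (s ^ 2 / v)) := by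
  have hv' : (v : ℝ) ≠ 0 := by exact_mod_cast hv
  have hq : ((Real.toNNReal (s ^ 2 / v) : ℝ≥0) : ℝ) = s ^ 2 / v :=
    Real.coe_toNNReal _ (by positivity)
  refine ⟨by fun_prop, fun x => ?_, ?_, fun f hf => ?_⟩
  · rw [hq]; ring
  · rw [gaussianReal_map_const_mul, mul_zero]
    congr 1
    ext
    rw [hq]
    push_cast
    field_simp
  · rw [gaussianReal_of_var_ne_zero _ hv,
      lintegral_withDensity_eq_lintegral_mul (g := fun x => f (x + s)) _
        (measurable_gaussianPDF 0 v) (by fun_prop),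
      lintegral_withDensity_eq_lintegral_mul _ (measurable_gaussianPDF 0 v) (by fun_prop),
      ← lintegral_sub_right_eq_self _ s]
    refine lintegral_congr fun x => ?_
    simp only [Pi.mul_apply, sub_add_cancel]
    rw [← mul_assoc]
    congr 1
    rw [gaussianPDF, gaussianPDF, ← ENNReal.ofReal_mul (gaussianPDFReal_nonneg _ _ _)]
    congr 1
    rw [gaussianPDFReal, gaussianPDFReal, mul_assoc (√(2 * Real.pi * v))⁻¹, ← Real.exp_add, hq]
    congr 2
    field_simp
    ring

theorem IsGaussianShift.prod {α β : Type*} [MeasurableSpace α] [MeasurableSpace β] [Add α] [Add β]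
    [MeasurableAdd α] [MeasurableAdd β]
    {μ : Measure α} {ν : Measure β} [IsProbabilityMeasure μ] [IsProbabilityMeasure ν]
    {s : α} {t : β} {ℓ : α → ℝ} {k : β → ℝ} {q r : ℝ≥0}
    (h : IsGaussianShift μ s ℓ q) (h' : IsGaussianShift ν t k r) :
    IsGaussianShift (μ.prod ν) (s, t) (fun p => ℓ p.1 + k p.2) (q + r) := by
  have hℓ := h.measurable_logDensity
  have hk := h'.measurable_logDensity
  refine ⟨by fun_prop, fun x => ?_, ?_, fun f hf => ?_⟩
  · simp only [Prod.fst_add, Prod.snd_add, h.logDensity_add, h'.logDensity_add]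
    push_cast
    ring
  · have hind : IndepFun (fun p : α × β => ℓ p.1) (fun p : α × β => k p.2) (μ.prod ν) :=
      indepFun_prod hℓ hk
    have h1 : (μ.prod ν).map (fun p : α × β => ℓ p.1) = gaussianReal 0 q := by
      rw [← h.map_logDensity]
      exact ((Measure.map_map hℓ measurable_fst).symm.trans (by simp [Measure.map_fst_prod]))
    have h2 : (μ.prod ν).map (fun p : α × β => k p.2) = gaussianReal 0 r := by
      rw [← h'.map_logDensity]
      exact ((Measure.map_map hk measurable_snd).symm.trans (by simp [Measure.map_snd_prod]))
    have := gaussianReal_add_gaussianReal_of_indepFun hind h1 h2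
    rw [add_zero] at this
    exact this
  · have hadd : Measurable fun p : α × β => f (p + (s, t)) :=
      hf.comp (((measurable_add_const s).comp measurable_fst).prodMk
        ((measurable_add_const t).comp measurable_snd))
    rw [lintegral_prod _ hadd.aemeasurable, lintegral_prod _ (by fun_prop)]
    have inner : ∀ x, ∫⁻ y, f ((x, y) + (s, t)) ∂ν =
        ∫⁻ y, ENNReal.ofReal (Real.exp (k y - r / 2)) * f (x + s, y) ∂ν := fun x =>
      h'.lintegral_add (fun y => f (x + s, y)) (by fun_prop)
    simp only [inner]
    rw [h.lintegral_add
      (fun x => ∫⁻ y, ENNReal.ofReal (Real.exp (k y - r / 2)) * f (x, y) ∂ν)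
      (Measurable.lintegral_prod_right (by fun_prop))]
    refine lintegral_congr fun x => ?_
    rw [← lintegral_const_mul _ (by fun_prop)]
    refine lintegral_congr fun y => ?_
    rw [← mul_assoc, ← ENNReal.ofReal_mul (Real.exp_nonneg _), ← Real.exp_add]
    congr 3
    push_cast
    ring

theorem IsGaussianShift.of_measurePreserving {α β : Type*} [MeasurableSpace α] [MeasurableSpace β]
    [Add α] [Add β] {μ : Measure α} {ν : Measure β} {s : α} {ℓ : β → ℝ} {q : ℝ≥0} (e : α ≃ᵐ β)
    (he : MeasurePreserving e μ ν) (hadd : ∀ x y, e (x + y) = e x + e y)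
    (h : IsGaussianShift ν (e s) ℓ q) : IsGaussianShift μ s (fun x => ℓ (e x)) q := by
  have hℓ := h.measurable_logDensity
  refine ⟨hℓ.comp e.measurable, fun x => ?_, ?_, fun f hf => ?_⟩
  · rw [hadd, h.logDensity_add]
  · rw [← h.map_logDensity, ← he.map_eq, Measure.map_map hℓ e.measurable]
    rfl
  · have hf' : Measurable fun y => f (e.symm y) := hf.comp e.symm.measurable
    have := h.lintegral_add _ hf'
    rw [← he.map_eq, lintegral_map_equiv, lintegral_map_equiv] at this
    simpa [← hadd] using this

theorem exists_isGaussianShift_pi {α : Type*} [MeasurableSpace α] [Add α]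
    [MeasurableAdd α] (μ : Measure α) [IsProbabilityMeasure μ] {n : ℕ} (s : Fin n → α)
    (q : Fin n → ℝ≥0) (h : ∀ i, ∃ ℓ, IsGaussianShift μ (s i) ℓ (q i)) :
    ∃ ℓ, IsGaussianShift (Measure.pi fun _ : Fin n => μ) s ℓ (∑ i, q i) := by
  induction n with
  | zero =>
    refine ⟨fun _ => 0, measurable_const, fun x => by simp, ?_, fun f hf => ?_⟩
    · simp [Measure.map_const]
    · have : ∀ x, x + s = x := fun x => Subsingleton.elim _ _
      simp [this]
  | succ n ih =>
    obtain ⟨ℓ, hℓ⟩ := h 0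
    obtain ⟨k, hk⟩ := ih (fun i => s i.succ) (fun i => q i.succ) fun i => h i.succ
    have hmp := measurePreserving_piFinSuccAbove (fun _ : Fin (n + 1) => μ) 0
    refine ⟨_, IsGaussianShift.of_measurePreserving
      (MeasurableEquiv.piFinSuccAbove (fun _ : Fin (n + 1) => α) 0) hmp (fun x y => rfl)
      (ℓ := fun p => ℓ p.1 + k p.2) ?_⟩
    rw [Fin.sum_univ_succ]
    exact hℓ.prod hk

theorem exists_isGaussianShift_noiseLaw {n T : ℕ} {vInd vCan : ℝ≥0} (hInd : vInd ≠ 0)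
    (hCan : vCan ≠ 0) (θ : Fin n → ℝ) (Δ : Fin n → Fin T → ℝ) :
    ∃ ℓ q, IsGaussianShift (noiseLaw n T vInd vCan) (θ, Δ) ℓ q ∧
      (q : ℝ) = (∑ i, θ i ^ 2) / vInd + (∑ i, ∑ k, Δ i k ^ 2) / vCan := by
  obtain ⟨ℓ, hℓ⟩ := exists_isGaussianShift_pi (gaussianReal 0 vInd) θ
    (fun i => Real.toNNReal (θ i ^ 2 / vInd)) fun i => ⟨_, isGaussianShift_gaussianReal hInd _⟩
  obtain ⟨k, hk⟩ := exists_isGaussianShift_pi (Measure.pi fun _ : Fin T => gaussianReal 0 vCan) Δ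
    (fun i => ∑ k, Real.toNNReal (Δ i k ^ 2 / vCan)) fun i =>
      exists_isGaussianShift_pi (gaussianReal 0 vCan) (Δ i) _
        fun k => ⟨_, isGaussianShift_gaussianReal hCan _⟩
  refine ⟨_, _, hℓ.prod hk, ?_⟩
  have h : ∀ (a : ℝ) (v : ℝ≥0), max (a ^ 2 / (v : ℝ)) 0 = a ^ 2 / v := fun a v =>
    max_eq_left (by positivity)
  push_cast
  simp only [Real.coe_toNNReal', h, Finset.sum_div]

/-! ### The Gaussian mechanism -/

theorem gaussianReal_Ioi_zero_le : gaussianReal 0 1 (Set.Ioi 0) ≤ ENNReal.ofReal (1 / 2) := by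
  have hsymm : gaussianReal 0 1 (Set.Iio 0) = gaussianReal 0 1 (Set.Ioi 0) := by
    have h := gaussianReal_map_neg (μ := 0) (v := 1)
    rw [neg_zero] at h
    conv_lhs => rw [← h]
    rw [Measure.map_apply measurable_neg measurableSet_Iio]
    congr 1
    ext x
    simp
  have hle : gaussianReal 0 1 (Set.Iio 0) + gaussianReal 0 1 (Set.Ioi 0) ≤ 1 := by
    rw [← measure_union _ measurableSet_Ioi]
    · exact prob_le_one
    · exact Set.disjoint_left.2 fun x (h : x < 0) (h' : 0 < x) => lt_asymm h h'
  rw [hsymm, ← two_mul] at hle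
  rw [one_div, ENNReal.ofReal_inv_of_pos two_pos, ENNReal.ofReal_ofNat,
    ENNReal.le_inv_iff_mul_le, mul_comm]
  exact hle

theorem gaussianReal_Ioi_le_exp {t : ℝ} (ht : 0 ≤ t) :
    gaussianReal 0 1 (Set.Ioi t) ≤ ENNReal.ofReal (Real.exp (-t ^ 2 / 2) / 2) := by
  have h := (isGaussianShift_gaussianReal one_ne_zero (-t)).lintegral_add
    ((Set.Ioi 0).indicator 1) (measurable_one.indicator measurableSet_Ioi)
  have hl : (fun x : ℝ => (Set.Ioi (0 : ℝ)).indicator (1 : ℝ → ℝ≥0∞) (x + -t)) =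
      (Set.Ioi t).indicator 1 := by
    ext x
    simp [Set.indicator]
  rw [hl, lintegral_indicator_one measurableSet_Ioi] at h
  rw [h]
  calc _ ≤ ∫⁻ x, ENNReal.ofReal (Real.exp (-t ^ 2 / 2)) * (Set.Ioi (0 : ℝ)).indicator 1 x
          ∂(gaussianReal 0 1) := by
        refine lintegral_mono fun x => ?_
        by_cases hx : 0 < x
        · gcongr
          rw [Real.coe_toNNReal _ (by positivity)]
          simp only [NNReal.coe_one, div_one, neg_mul]
          nlinarith [mul_nonneg ht hx.le]
        · simp [Set.indicator, hx]
    _ = ENNReal.ofReal (Real.exp (-t ^ 2 / 2)) * gaussianReal 0 1 (Set.Ioi 0) := by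
        rw [lintegral_const_mul _ (measurable_one.indicator measurableSet_Ioi),
          lintegral_indicator_one measurableSet_Ioi]
    _ ≤ ENNReal.ofReal (Real.exp (-t ^ 2 / 2)) * ENNReal.ofReal (1 / 2) := by
        gcongr
        exact gaussianReal_Ioi_zero_le
    _ = _ := by
        rw [← ENNReal.ofReal_mul (Real.exp_nonneg _)]
        congr 1
        ring

theorem gaussianReal_Ioi_neg_le {t : ℝ} (ht : t ≤ 0) :
    gaussianReal 0 1 (Set.Ioi t) ≤ ENNReal.ofReal (1 / 2 - t) := by
  have hpdf : ∀ x, gaussianPDF 0 1 x ≤ 1 := fun x => by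
    rw [gaussianPDF, ENNReal.ofReal_le_one, gaussianPDFReal]
    have h1 : (1 : ℝ) ≤ √(2 * Real.pi * (1 : ℝ≥0)) := by
      rw [Real.one_le_sqrt]
      simp only [NNReal.coe_one]
      linarith [Real.pi_gt_three]
    have h2 : Real.exp (-(x - 0) ^ 2 / (2 * (1 : ℝ≥0))) ≤ 1 := by
      rw [Real.exp_le_one_iff]
      simp only [NNReal.coe_one]
      nlinarith [sq_nonneg (x - 0)]
    exact mul_le_one₀ (inv_le_one_of_one_le₀ h1) (Real.exp_nonneg _) h2
  have hsmall : gaussianReal 0 1 (Set.Ioc t 0) ≤ ENNReal.ofReal (-t) := by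
    rw [gaussianReal_apply _ one_ne_zero]
    calc _ ≤ ∫⁻ _ in Set.Ioc t 0, 1 := lintegral_mono fun x => hpdf x
      _ = _ := by simp
  calc _ = gaussianReal 0 1 (Set.Ioc t 0 ∪ Set.Ioi 0) := by rw [Set.Ioc_union_Ioi_eq_Ioi ht]
    _ ≤ gaussianReal 0 1 (Set.Ioc t 0) + gaussianReal 0 1 (Set.Ioi 0) := measure_union_le _ _
    _ ≤ ENNReal.ofReal (-t) + ENNReal.ofReal (1 / 2) := add_le_add hsmall gaussianReal_Ioi_zero_le
    _ = _ := by
      rw [← ENNReal.ofReal_add (by linarith) (by norm_num)]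
      congr 1
      ring

/-- The tail bound that calibrates the Gaussian mechanism. The bound `exp (-t ^ 2 / 2) / 2` suffices
unless `κ - 1 / (2 * κ) < 0`. Then `δ` is so close to `1` that a crude bound does. -/
theorem gaussianReal_Ioi_le_of_log_lt {κ δ : ℝ} (hκ : 0 < κ) (hδ : 0 < δ) (hδ1 : δ < 1)
    (h : 2 * Real.log (1.25 / δ) < κ ^ 2) :
    gaussianReal 0 1 (Set.Ioi (κ - 1 / (2 * κ))) ≤ ENNReal.ofReal δ := by
  have hδκ : 1.25 * Real.exp (-κ ^ 2 / 2) < δ := by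
    have h1 : 1.25 / δ < Real.exp (κ ^ 2 / 2) := by
      rw [← Real.log_lt_iff_lt_exp (by positivity)]
      linarith
    rw [neg_div, Real.exp_neg, ← div_eq_mul_inv, div_lt_comm₀ (Real.exp_pos _) hδ]
    exact h1
  rcases le_or_gt 0 (κ - 1 / (2 * κ)) with ht | ht
  · refine (gaussianReal_Ioi_le_exp ht).trans (ENNReal.ofReal_le_ofReal ?_)
    have hsq : -(κ - 1 / (2 * κ)) ^ 2 / 2 ≤ 1 / 2 + -κ ^ 2 / 2 := by
      have : -(κ - 1 / (2 * κ)) ^ 2 / 2 = 1 / 2 + -κ ^ 2 / 2 - 1 / (8 * κ ^ 2) := by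
        field_simp
        ring
      rw [this]
      linarith [show 0 < 1 / (8 * κ ^ 2) by positivity]
    have hexp := Real.exp_le_exp.2 hsq
    rw [Real.exp_add] at hexp
    have hhalf : Real.exp (1 / 2) ≤ 2.5 := by
      have h1 : Real.exp (1 / 2) ≤ Real.exp 1 := Real.exp_le_exp.2 (by norm_num)
      have h2 : Real.exp (1 / 2) * Real.exp (1 / 2) = Real.exp 1 := by
        rw [← Real.exp_add]
        norm_num
      nlinarith [Real.exp_one_lt_d9, Real.exp_pos (1 / 2)]
    have := mul_le_mul_of_nonneg_right hhalf (Real.exp_nonneg (-κ ^ 2 / 2))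
    linarith
  · refine (gaussianReal_Ioi_neg_le ht.le).trans (ENNReal.ofReal_le_ofReal ?_)
    have hup : κ ^ 2 < 1 / 2 := by
      rw [sub_neg, lt_div_iff₀ (by positivity)] at ht
      linarith
    have hδ2 : 0.9375 < δ := by
      have := Real.add_one_le_exp (-κ ^ 2 / 2)
      linarith
    have hlow : 0.4 < κ ^ 2 := by
      have := Real.one_sub_inv_le_log_of_pos (show 0 < 1.25 / δ by positivity)
      rw [inv_div] at this
      have h8 : δ / 1.25 ≤ 0.8 := by
        rw [div_le_iff₀ (by norm_num)]
        linarith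
      linarith
    have hκ' : 0.6 < κ := by nlinarith
    have : 1 / (2 * κ) < κ + 0.4 := by
      rw [div_lt_iff₀ (by positivity)]
      nlinarith
    linarith

/-- The Gaussian mechanism: a translation of squared norm `q ≤ (ε / κ) ^ 2` is hidden up to
`(ε, δ)`. On the set where the density of the translate is at most `exp ε`, this is clear, and
the translate gives the complement only the mass of a normal tail. -/
theorem IsGaussianShift.measure_le {α : Type*} [MeasurableSpace α] [Add α]
    [MeasurableAdd α] {μ : Measure α} {s : α} {ℓ : α → ℝ} {q : ℝ≥0}
    (h : IsGaussianShift μ s ℓ q) {ε δ κ : ℝ} (hε : 0 < ε) (hε1 : ε < 1) (hδ : 0 < δ) (hδ1 : δ < 1)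
    (hκ : 2 * Real.log (1.25 / δ) < κ ^ 2) (hq : (q : ℝ) ≤ ε ^ 2 / κ ^ 2) {B : Set α}
    (hB : MeasurableSet B) :
    μ {x | x + s ∈ B} ≤ ENNReal.ofReal (Real.exp ε) * μ B + ENNReal.ofReal δ := by
  wlog hpos : 0 < κ generalizing κ
  · refine this (κ := -κ) (by rwa [neg_sq]) (by rwa [neg_sq]) ?_
    have hκ2 : 0 < κ ^ 2 := by
      have : 0 < Real.log (1.25 / δ) := Real.log_pos (by rw [lt_div_iff₀ hδ]; linarith)
      linarith
    have : κ ≠ 0 := fun h0 => by simp [h0] at hκ2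
    exact neg_pos.2 (lt_of_le_of_ne (not_lt.1 hpos) this)
  have hℓ := h.measurable_logDensity
  have htail : gaussianReal 0 q (Set.Ioi (ε - q / 2)) ≤ ENNReal.ofReal δ := by
    rcases eq_or_ne q 0 with rfl | hq0
    · rw [gaussianReal_zero_var, Measure.dirac_apply' _ measurableSet_Ioi]
      simp [hε.le]
    have hq0' : 0 < (q : ℝ) := by positivity
    have hρ : 0 < √(q : ℝ) := Real.sqrt_pos.2 hq0'
    have hρq : √(q : ℝ) ^ 2 = q := Real.sq_sqrt hq0'.le
    have hstd : (gaussianReal 0 1).map (√(q : ℝ) * ·) = gaussianReal 0 q := by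
      rw [gaussianReal_map_const_mul, mul_zero, mul_one]
      congr 1
      ext
      exact hρq
    rw [← hstd, Measure.map_apply (by fun_prop) measurableSet_Ioi]
    refine (measure_mono fun x hx => ?_).trans (gaussianReal_Ioi_le_of_log_lt hpos hδ hδ1 hκ)
    simp only [Set.mem_preimage, Set.mem_Ioi] at hx ⊢
    have hρε : κ * √(q : ℝ) ≤ ε := by
      rw [le_div_iff₀ (by positivity), ← hρq, ← mul_pow] at hq
      rw [mul_comm]
      exact le_of_sq_le_sq hq hε.le
    have h2 : √(q : ℝ) / 2 ≤ 1 / (2 * κ) := by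
      rw [div_le_div_iff₀ two_pos (by positivity)]
      linarith
    have h3 : κ - √(q : ℝ) / 2 < x := by
      rw [← sub_pos] at hx ⊢
      refine pos_of_mul_pos_right (a := √(q : ℝ)) ?_ hρ.le
      nlinarith
    linarith
  have hM : MeasurableSet {x | ε < ℓ x - q / 2} :=
    measurableSet_lt measurable_const (hℓ.sub_const _)
  have hadd : Measurable fun x : α => x + s := measurable_add_const s
  have hsplit : {x | x + s ∈ B} ⊆
      {x | x + s ∈ B \ {x | ε < ℓ x - q / 2}} ∪ ℓ ⁻¹' Set.Ioi (ε - q / 2) := fun x hx => by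
    by_cases hx' : ε < ℓ (x + s) - q / 2
    · right
      rw [h.logDensity_add] at hx'
      simp only [Set.mem_preimage, Set.mem_Ioi]
      linarith
    · exact Or.inl ⟨hx, hx'⟩
  refine (measure_mono hsplit).trans ((measure_union_le _ _).trans (add_le_add ?_ ?_))
  · have hBM := hB.diff hM
    have hl := h.lintegral_add _ (measurable_one.indicator hBM)
    have : (fun x => (B \ {x | ε < ℓ x - q / 2}).indicator (1 : α → ℝ≥0∞) (x + s)) =
        {x | x + s ∈ B \ {x | ε < ℓ x - q / 2}}.indicator 1 := rfl
    have hone : ∫⁻ x, {x | x + s ∈ B \ {x | ε < ℓ x - q / 2}}.indicator 1 x ∂μ =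
        μ {x | x + s ∈ B \ {x | ε < ℓ x - q / 2}} := lintegral_indicator_one (hadd hBM)
    rw [this, hone] at hl
    rw [hl, ← lintegral_indicator_one hB,
      ← lintegral_const_mul _ (measurable_one.indicator hB)]
    refine lintegral_mono fun x => ?_
    by_cases hx : x ∈ B \ {x | ε < ℓ x - q / 2}
    · rw [Set.indicator_of_mem hx, Set.indicator_of_mem hx.1]
      gcongr
      exact not_lt.1 hx.2
    · simp [Set.indicator_of_notMem hx]
  · rw [← Measure.map_apply hℓ measurableSet_Ioi, h.map_logDensity]
    exact htail

namespace Execution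

variable {n T : ℕ} (E : Execution n T)

/-! ### Linearity of the protocol -/

theorem message_zero (u : Fin n → ℝ) (g : Fin n → Fin T → ℝ) (i : Fin n) :
    E.message u g 0 i = E.inject u g i 0 := rfl

theorem message_succ (u : Fin n → ℝ) (g : Fin n → Fin T → ℝ) (t : Fin T) (i : Fin n) :
    E.message u g t.succ i =
      if i ∈ E.online t.succ then
        ∑ j, E.weightOn t i j * E.message u g t.castSucc j + E.inject u g i t.succ
      else E.message u g t.castSucc i := rfl

theorem message_eq_of_recursion {u : Fin n → ℝ} {g : Fin n → Fin T → ℝ}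
    {m : Fin (T + 1) → Fin n → ℝ} (h0 : ∀ i, m 0 i = E.inject u g i 0)
    (hs : ∀ (t : Fin T) i, m t.succ i =
      if i ∈ E.online t.succ then
        ∑ j, E.weightOn t i j * m t.castSucc j + E.inject u g i t.succ
      else m t.castSucc i) :
    E.message u g = m := by
  funext t
  induction t using Fin.induction with
  | zero => exact funext fun i => (h0 i).symm
  | succ t ih =>
    funext i
    rw [message_succ, ih, hs]

theorem inject_add (u u' : Fin n → ℝ) (g g' : Fin n → Fin T → ℝ) (i : Fin n) (t : Fin (T + 1)) :
    E.inject (u + u') (g + g') i t = E.inject u g i t + E.inject u' g' i t := by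
  simp only [inject, Pi.add_apply, mul_add, Finset.sum_add_distrib]
  ring

theorem inject_smul (a : ℝ) (u : Fin n → ℝ) (g : Fin n → Fin T → ℝ) (i : Fin n)
    (t : Fin (T + 1)) : E.inject (a • u) (a • g) i t = a * E.inject u g i t := by
  simp only [inject, Pi.smul_apply, smul_eq_mul, mul_add, Finset.mul_sum]
  congr 1
  · ring
  · exact Finset.sum_congr rfl fun k _ => by ring

theorem message_add (u u' : Fin n → ℝ) (g g' : Fin n → Fin T → ℝ) :
    E.message (u + u') (g + g') = E.message u g + E.message u' g' := by
  refine E.message_eq_of_recursion (fun i => ?_) fun t i => ?_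
  · simp only [Pi.add_apply, message_zero, inject_add]
  · simp only [Pi.add_apply, message_succ, inject_add]
    split_ifs
    · simp only [mul_add, Finset.sum_add_distrib]
      ring
    · rfl

theorem message_smul (a : ℝ) (u : Fin n → ℝ) (g : Fin n → Fin T → ℝ) :
    E.message (a • u) (a • g) = a • E.message u g := by
  refine E.message_eq_of_recursion (fun i => ?_) fun t i => ?_
  · simp only [Pi.smul_apply, smul_eq_mul, message_zero, inject_smul]
  · simp only [Pi.smul_apply, smul_eq_mul, message_succ, inject_smul]
    split_ifs
    · rw [mul_add, Finset.mul_sum]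
      congr 1
      exact Finset.sum_congr rfl fun j _ => by ring
    · rfl

theorem view_add (u u' : Fin n → ℝ) (g g' : Fin n → Fin T → ℝ) :
    E.view (u + u') (g + g') = E.view u g + E.view u' g' := by
  funext p
  simp only [view, message_add, Pi.add_apply]

theorem view_smul (a : ℝ) (u : Fin n → ℝ) (g : Fin n → Fin T → ℝ) :
    E.view (a • u) (a • g) = a • E.view u g := by
  funext p
  simp only [view, message_smul, Pi.smul_apply]

/-! ### The weights that are really used -/

theorem weightOn_of_row_offline {t : Fin T} {i : Fin n} (h : i ∉ E.online t.succ) (j : Fin n) :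
    E.weightOn t i j = if i = j then 1 else 0 := by
  simp [weightOn, h]

theorem weightOn_of_col_offline {t : Fin T} {j : Fin n} (h : j ∉ E.online t.succ) (i : Fin n) :
    E.weightOn t i j = if i = j then 1 else 0 := by
  rcases eq_or_ne i j with rfl | hij
  · simp [weightOn, h]
  · simp [weightOn, h, hij]

variable {E}

theorem ColumnStochastic.sum_weightOn (hcol : E.ColumnStochastic) (t : Fin T) (j : Fin n) :
    ∑ i, E.weightOn t i j = 1 := by
  by_cases hj : j ∈ E.online t.succ
  · have hcol' := hcol t j
    rw [← Finset.sum_add_sum_compl (E.online t.succ), ← Finset.add_sum_erase _ _ hj] at hcol' ⊢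
    have h1 : ∑ i ∈ (E.online t.succ)ᶜ, E.weightOn t i j = 0 :=
      Finset.sum_eq_zero fun i hi => by
        rw [Finset.mem_compl] at hi
        rw [weightOn_of_row_offline E hi, if_neg (ne_of_mem_of_not_mem hj hi).symm]
    have h2 : ∑ i ∈ (E.online t.succ).erase j, E.weightOn t i j =
        ∑ i ∈ (E.online t.succ).erase j, E.weight t i j :=
      Finset.sum_congr rfl fun i hi => by
        rw [Finset.mem_erase] at hi
        simp [weightOn, hi, hj]
    have h3 : E.weightOn t j j = E.weight t j j + ∑ k ∈ (E.online t.succ)ᶜ, E.weight t k j := by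
      simp [weightOn, hj]
    rw [h1, h2, h3, ← hcol']
    ring
  · simp [weightOn_of_col_offline E hj]

/-- A message that the adversary does not observe is not sent to any corrupted party. -/
theorem weightOn_eq_zero_of_unobserved (hadv : E.Eavesdropping ∨ E.Collusion) {t : Fin T}
    {i j : Fin n} (hi : i ∈ E.corrupted) (hj : j ∉ E.corrupted)
    (hobs : (j, t.castSucc) ∉ E.observed) : E.weightOn t i j = 0 := by
  have hij : i ≠ j := fun h => hj (h ▸ hi)
  rcases hadv with h | h
  · simp [h.1] at hi
  · have hw : E.weight t i j = 0 := by
      by_contra hne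
      refine hobs ((h j t.castSucc).2 (Or.inr ⟨t, rfl, i, hi, Or.inr ?_⟩))
      exact (E.weight_support t i j hne).resolve_left hij
    simp [weightOn, hij, hw]

variable (E)

/-! ### Which injections a party can produce -/

theorem onlineCount_le (i : Fin n) (t : Fin (T + 1)) : E.onlineCount i t ≤ t := by
  have : (Finset.univ.filter fun s : Fin (T + 1) => 0 < s ∧ s ≤ t ∧ i ∈ E.online s) ⊆
      Finset.Ioc 0 t := fun s hs => by
    simp only [Finset.mem_filter] at hs
    exact Finset.mem_Ioc.2 ⟨hs.2.1, hs.2.2.1⟩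
  simpa [onlineCount] using Finset.card_le_card this

theorem row_lt_row {i : Fin n} {s t : Fin (T + 1)} (hst : s < t) (ht : i ∈ E.online t) :
    E.row i s < E.row i t := by
  rw [Fin.lt_def]
  change E.onlineCount i s < E.onlineCount i t
  refine Finset.card_lt_card (Finset.ssubset_iff_of_subset ?_ |>.2 ⟨t, ?_, ?_⟩)
  · intro r hr
    simp only [Finset.mem_filter, Finset.mem_univ, true_and] at hr ⊢
    exact ⟨hr.1, hr.2.1.trans hst.le, hr.2.2⟩
  · simp only [Finset.mem_filter, Finset.mem_univ, true_and]
    exact ⟨(Fin.zero_le s).trans_lt hst, le_rfl, ht⟩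
  · simp [hst]

theorem row_inj {i : Fin n} {s t : Fin (T + 1)} (hs : i ∈ E.online s) (ht : i ∈ E.online t)
    (h : E.row i s = E.row i t) : s = t := by
  rcases lt_trichotomy s t with hst | hst | hst
  · exact absurd h (E.row_lt_row hst ht).ne
  · exact hst
  · exact absurd h (E.row_lt_row hst hs).ne'

/-- A party that is online at the last iteration has by then used every row before its current
one exactly once. -/
theorem image_row_eq {i : Fin n} (hi : i ∈ E.online (Fin.last T)) :
    (Finset.univ.filter fun t => t < Fin.last T ∧ i ∈ E.online t).image (E.row i) =
      Finset.univ.filter fun s => s < E.row i (Fin.last T) := by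
  refine Finset.eq_of_subset_of_card_le (fun s hs => ?_) ?_
  · obtain ⟨t, ht, rfl⟩ := Finset.mem_image.1 hs
    simp only [Finset.mem_filter, Finset.mem_univ, true_and] at ht ⊢
    exact E.row_lt_row ht.1 hi
  · rw [Finset.card_image_of_injOn fun s hs t ht h => E.row_inj (by simp_all) (by simp_all) h]
    have h1 : (Finset.univ.filter fun s => s < E.row i (Fin.last T)).card =
        E.onlineCount i (Fin.last T) := by
      rw [Finset.filter_gt_eq_Iio, Fin.card_Iio]
      rfl
    rw [h1]
    -- Both sides count the online times up to `T`: the left side omits `T`, the right side `0`.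
    have h2 : insert (Fin.last T)
        (Finset.univ.filter fun t => t < Fin.last T ∧ i ∈ E.online t) =
        insert 0 (Finset.univ.filter fun s : Fin (T + 1) =>
          0 < s ∧ s ≤ Fin.last T ∧ i ∈ E.online s) := by
      ext t
      simp only [Finset.mem_insert, Finset.mem_filter, Finset.mem_univ, true_and, Fin.le_last]
      rcases eq_or_ne t 0 with rfl | h0
      · simp [E.online_zero, or_iff_not_imp_left, Fin.lt_last_iff_ne_last]
      · rcases eq_or_ne t (Fin.last T) with rfl | hT
        · simp [hi, Fin.pos_iff_ne_zero, h0]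
        · simp [h0, hT, Fin.pos_iff_ne_zero, Fin.lt_last_iff_ne_last]
    have h3 := congrArg Finset.card h2
    rw [Finset.card_insert_of_notMem (by simp), Finset.card_insert_of_notMem (by simp)] at h3
    exact (Nat.succ_injective h3).ge

/-- The canceling noise of a party can produce any injections whose sum is right: as the first `T`
rows of `Z` form an invertible matrix, all injections before the last one can be prescribed, and
a party that is online at the last iteration makes up for the rest. -/
theorem exists_inject_eq (hZ : IsUnit (Matrix.of fun t k => E.Z t.castSucc k :
    Matrix (Fin T) (Fin T) ℝ)) (i : Fin n) (a : ℝ) (v : Fin (T + 1) → ℝ)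
    (hv : ∀ t, i ∉ E.online t → v t = 0) (hsum : ∑ t, v t = E.totalWeight i * a) :
    ∃ d : Fin T → ℝ, ∀ t, E.cOn i t * a + ∑ k, E.ZOn i t k * d k = v t := by
  obtain ⟨d, hd⟩ : ∃ d : Fin T → ℝ, ∀ s : Fin T, ∑ k, E.Z s.castSucc k * d k =
      (∑ t ∈ Finset.univ.filter fun t => i ∈ E.online t ∧ E.row i t = s.castSucc, v t) -
        E.c s.castSucc * a := by
    obtain ⟨d, hd⟩ := (Matrix.mulVec_surjective_iff_isUnit.2 hZ) fun s =>
      (∑ t ∈ Finset.univ.filter fun t => i ∈ E.online t ∧ E.row i t = s.castSucc, v t) -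
        E.c s.castSucc * a
    exact ⟨d, fun s => congrFun hd s⟩
  have hrow : ∀ t, t < Fin.last T → i ∈ E.online t →
      ∑ k, E.Z (E.row i t) k * d k = v t - E.c (E.row i t) * a := fun t ht hi => by
    have hlt : E.onlineCount i t < T := (E.onlineCount_le i t).trans_lt (Fin.lt_def.1 ht)
    have hs := hd ⟨_, hlt⟩
    have hr : (Fin.castSucc ⟨E.onlineCount i t, hlt⟩ : Fin (T + 1)) = E.row i t := rfl
    have hf : (Finset.univ.filter fun t' => i ∈ E.online t' ∧ E.row i t' = E.row i t) = {t} := by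
      ext t'
      simp only [Finset.mem_filter, Finset.mem_univ, true_and, Finset.mem_singleton]
      exact ⟨fun h => E.row_inj h.1 hi h.2, fun h => by rw [h]; exact ⟨hi, rfl⟩⟩
    rwa [hr, hf, Finset.sum_singleton] at hs
  refine ⟨d, fun t => ?_⟩
  by_cases hi : i ∈ E.online t
  · rcases eq_or_ne t (Fin.last T) with rfl | hT
    · have hZs : ∑ k, E.ZOn i (Fin.last T) k * d k =
          - ∑ s ∈ Finset.univ.filter fun s => s < E.row i (Fin.last T), ∑ k, E.Z s k * d k := by
        simp only [ZOn, hi, if_true, neg_mul, Finset.sum_neg_distrib, Finset.sum_mul]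
        rw [Finset.sum_comm]
      have hsplit : ∀ f : Fin (T + 1) → ℝ, (∀ t, i ∉ E.online t → f t = 0) → ∑ t, f t =
          (∑ t ∈ Finset.univ.filter fun t => t < Fin.last T ∧ i ∈ E.online t, f t) +
            f (Fin.last T) := fun f hf => by
        rw [← Finset.sum_erase_add _ _ (Finset.mem_univ (Fin.last T))]
        congr 1
        refine (Finset.sum_subset (fun t ht => ?_) fun t ht ht' => hf t fun h => ht' ?_).symm
        · simp only [Finset.mem_filter, Finset.mem_univ, true_and] at ht
          simp [ht.1.ne]
        · simp only [Finset.mem_erase, Finset.mem_univ, and_true] at ht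
          simp [Fin.lt_last_iff_ne_last, ht, h]
      have hc : ∀ t ∈ Finset.univ.filter fun t => t < Fin.last T ∧ i ∈ E.online t,
          E.c (E.row i t) = E.cOn i t := fun t ht => by
        simp only [Finset.mem_filter, Finset.mem_univ, true_and] at ht
        simp [cOn, ht.2]
      have hw : E.totalWeight i = _ := hsplit (E.cOn i) fun t ht => by simp [cOn, ht]
      rw [hZs, ← E.image_row_eq hi,
        Finset.sum_image fun s hs t ht h => E.row_inj (by simp_all) (by simp_all) h,
        Finset.sum_congr rfl fun t ht => hrow t (by simp_all) (by simp_all),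
        Finset.sum_sub_distrib, ← Finset.sum_mul, Finset.sum_congr rfl hc]
      rw [hsplit v hv, hw] at hsum
      linarith
    · have h1 := hrow t (Fin.lt_last_iff_ne_last.2 hT) hi
      simp only [cOn, ZOn, hi, if_true, hT, if_false]
      linarith
  · simp [cOn, ZOn, hi, hv t hi]

/-! ### Changes of the noisy values that the adversary cannot see -/

/-- The changes of the noisy values of the honest parties that some change of their canceling noise
hides from the adversary. -/
def hiddenChanges : Submodule ℝ (Fin n → ℝ) where
  carrier := {a | ∃ Δ : Fin n → Fin T → ℝ,
    (∀ i ∈ E.corrupted, a i = 0 ∧ Δ i = 0) ∧ E.view a Δ = 0}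
  zero_mem' := ⟨0, fun i _ => ⟨rfl, rfl⟩, by simpa using E.view_smul 0 0 0⟩
  add_mem' := by
    rintro a b ⟨Δ, h, hv⟩ ⟨Δ', h', hv'⟩
    refine ⟨Δ + Δ', fun i hi => ?_, by rw [view_add, hv, hv', add_zero]⟩
    simp [h i hi, h' i hi]
  smul_mem' := by
    rintro r a ⟨Δ, h, hv⟩
    refine ⟨r • Δ, fun i hi => ?_, by rw [view_smul, hv, smul_zero]⟩
    simp [h i hi]

variable {E}

/-- A party that is absent neither sends its message nor changes it. -/
theorem edgeVec_eq_zero_of_offline {i : Fin n} {t : Fin T} (h : i ∉ E.online t.succ) :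
    E.edgeVec i t = 0 := by
  funext j
  rcases eq_or_ne j i with rfl | hj
  · simp [edgeVec, weightOn_of_col_offline E h]
  · simp [edgeVec, weightOn_of_col_offline E h, hj]

/-- Let the message of party `i₀` that is sent in iteration `t₀ + 1`, and is kept by `i₀` since it
was last online, decrease by one, and let all other messages keep their values. The injections that
this requires of a party have the sum by which its total injection changes if its noisy value
changes by `E.edgeVec i₀ t₀`, so the canceling noise can bring them about. -/
theorem edgeVec_mem_hiddenChanges (hZ : IsUnit (Matrix.of fun t k => E.Z t.castSucc k :
    Matrix (Fin T) (Fin T) ℝ)) (hadv : E.Eavesdropping ∨ E.Collusion)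
    (hweight : ∀ i ∉ E.corrupted, E.totalWeight i ≠ 0) {i₀ : Fin n} {t₀ : Fin T}
    (hun : E.Unseen i₀ t₀.castSucc) : E.edgeVec i₀ t₀ ∈ E.hiddenChanges := by
  classical
  by_cases hon : i₀ ∈ E.online t₀.succ
  swap
  · rw [edgeVec_eq_zero_of_offline hon]
    exact Submodule.zero_mem _
  obtain ⟨hi₀, hun⟩ := hun
  -- the times at which `i₀` holds the message in question
  let χ : Fin (T + 1) → Prop := fun t =>
    t ≤ t₀.castSucc ∧ ∀ r, t < r → r ≤ t₀.castSucc → i₀ ∉ E.online r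
  have hχobs : ∀ t, χ t → (i₀, t) ∉ E.observed := fun t ht => hun t ht.1 ht.2
  have hχ₀ : χ t₀.castSucc := ⟨le_rfl, fun r h h' => absurd h' (not_le.2 h)⟩
  have hχlast : ¬ χ (Fin.last T) := fun h => absurd h.1 (not_le.2 (Fin.castSucc_lt_last t₀))
  have hχoff : ∀ t : Fin T, t ≠ t₀ → χ t.castSucc → i₀ ∉ E.online t.succ := fun t ht h => by
    have hlt : t < t₀ := lt_of_le_of_ne (Fin.castSucc_le_castSucc_iff.1 h.1) ht
    exact h.2 _ Fin.castSucc_lt_succ (Fin.succ_le_castSucc_iff.2 hlt)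
  have hχsucc : ∀ t : Fin T, i₀ ∉ E.online t.succ → (χ t.succ ↔ χ t.castSucc) := fun t ht => by
    have hne : t ≠ t₀ := fun h => ht (h ▸ hon)
    constructor
    · rintro ⟨h1, h2⟩
      refine ⟨Fin.castSucc_lt_succ.le.trans h1, fun r hr hr' => ?_⟩
      rcases (Fin.castSucc_lt_iff_succ_le.1 hr).eq_or_lt with rfl | h
      · exact ht
      · exact h2 r h hr'
    · rintro ⟨h1, h2⟩
      have hlt : t < t₀ := lt_of_le_of_ne (Fin.castSucc_le_castSucc_iff.1 h1) hne
      exact ⟨Fin.succ_le_castSucc_iff.2 hlt, fun r hr => h2 r (Fin.castSucc_lt_succ.trans hr)⟩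
  let μ : Fin (T + 1) → ℝ := fun t => if χ t then -1 else 0
  let m : Fin (T + 1) → Fin n → ℝ := fun t i => if i = i₀ then μ t else 0
  -- the injections that lead to these messages
  let v : Fin n → Fin (T + 1) → ℝ := fun i =>
    Fin.cons (m 0 i) fun t => m t.succ i - E.weightOn t i i₀ * μ t.castSucc
  have hWm : ∀ t i, ∑ j, E.weightOn t i j * m t.castSucc j =
      E.weightOn t i i₀ * μ t.castSucc := fun t i => by
    simp [m]
  have hvoff : ∀ i t, i ∉ E.online t → v i t = 0 := fun i t => by
    refine Fin.cases (fun h => absurd (by simp [E.online_zero]) h) (fun t h => ?_) t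
    simp only [v, Fin.cons_succ, weightOn_of_row_offline E h, m]
    by_cases hi : i = i₀
    · subst hi
      simp only [μ, hχsucc t h, if_true, one_mul, sub_self]
    · simp [hi]
  have hvsum : ∀ i, ∑ t, v i t = E.weightOn t₀ i i₀ - if i = i₀ then 1 else 0 := fun i => by
    have h1 : ∑ t : Fin T, m t.succ i = (∑ t : Fin T, m t.castSucc i) - m 0 i := by
      have := Fin.sum_univ_succ fun t => m t i
      rw [Fin.sum_univ_castSucc] at this
      have hm : m (Fin.last T) i = 0 := by simp [m, μ, hχlast]
      linarith
    have h2 : ∀ t : Fin T, m t.castSucc i - E.weightOn t i i₀ * μ t.castSucc =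
        if t = t₀ then E.weightOn t₀ i i₀ - (if i = i₀ then 1 else 0) else 0 := fun t => by
      by_cases ht : t = t₀
      · subst ht
        by_cases hi : i = i₀
        · simp [m, μ, hχ₀, hi]; ring
        · simp [m, μ, hχ₀, hi]
      · by_cases hc : χ t.castSucc
        · by_cases hi : i = i₀
          · simp [m, hi, ht, weightOn_of_col_offline E (hχoff t ht hc)]
          · simp [m, hi, ht, weightOn_of_col_offline E (hχoff t ht hc)]
        · simp [m, μ, hc, ht]
    rw [Fin.sum_univ_succ]
    simp only [v, Fin.cons_zero, Fin.cons_succ]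
    rw [Finset.sum_sub_distrib, h1]
    have h3 := Finset.sum_congr rfl fun t (_ : t ∈ (Finset.univ : Finset (Fin T))) => h2 t
    rw [Finset.sum_ite_eq' Finset.univ t₀, if_pos (Finset.mem_univ _),
      Finset.sum_sub_distrib] at h3
    linarith
  have hvcor : ∀ i ∈ E.corrupted, ∀ t, v i t = 0 := fun i hi t => by
    have hne : i ≠ i₀ := fun h => hi₀ (h ▸ hi)
    refine Fin.cases (by simp [v, m, hne]) (fun t => ?_) t
    simp only [v, Fin.cons_succ, m, if_neg hne, zero_sub, neg_eq_zero]
    by_cases hc : χ t.castSucc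
    · rw [weightOn_eq_zero_of_unobserved hadv hi hi₀ (hχobs _ hc), zero_mul]
    · simp [μ, hc]
  have hexists : ∀ i, ∃ d : Fin T → ℝ, (i ∈ E.corrupted → d = 0) ∧
      ∀ t, E.cOn i t * E.edgeVec i₀ t₀ i + ∑ k, E.ZOn i t k * d k = v i t := fun i => by
    by_cases hi : i ∈ E.corrupted
    · exact ⟨0, fun _ => rfl, fun t => by simp [edgeVec, hi, hvcor i hi t]⟩
    · obtain ⟨d, hd⟩ := E.exists_inject_eq hZ i (E.edgeVec i₀ t₀ i) (v i) (hvoff i) (by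
        rw [hvsum]
        by_cases h : i = i₀
        · subst h
          simp [edgeVec, hi, mul_div_cancel₀ _ (hweight i hi)]
        · simp [edgeVec, hi, h, mul_div_cancel₀ _ (hweight i hi)])
      exact ⟨d, fun h => absurd h hi, hd⟩
  choose Δ hΔcor hΔ using hexists
  have hmsg : E.message (E.edgeVec i₀ t₀) Δ = m := by
    refine E.message_eq_of_recursion (fun i => (hΔ i 0).symm) fun t i => ?_
    have hin : E.inject (E.edgeVec i₀ t₀) Δ i t.succ =
        m t.succ i - E.weightOn t i i₀ * μ t.castSucc := hΔ i t.succ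
    rw [hWm, hin]
    split_ifs with h
    · ring
    · have := hvoff i _ h
      simp only [v, Fin.cons_succ, weightOn_of_row_offline E h] at this
      rw [sub_eq_zero.1 this]
      simp only [m]
      split_ifs <;> simp
  refine ⟨Δ, fun i hi => ⟨by simp [edgeVec, hi], hΔcor i hi⟩, ?_⟩
  funext ⟨⟨i, t⟩, hp⟩
  simp only [view, hmsg, m, Pi.zero_apply]
  split_ifs with h
  · subst h
    exact if_neg fun hc => hχobs t hc hp
  · rfl

variable (E) in
/-- The changes of the noisy values of the honest parties that preserve the sum of what the
honest parties inject in total. -/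
def balancedChanges : Submodule ℝ (Fin n → ℝ) where
  carrier := {a | (∀ i ∈ E.corrupted, a i = 0) ∧ ∑ i ∈ E.corruptedᶜ, E.totalWeight i * a i = 0}
  zero_mem' := by simp
  add_mem' := by
    rintro a b ⟨h, hs⟩ ⟨h', hs'⟩
    refine ⟨fun i hi => by simp [h i hi, h' i hi], ?_⟩
    simp only [Pi.add_apply, mul_add, Finset.sum_add_distrib, hs, hs', add_zero]
  smul_mem' := by
    rintro r a ⟨h, hs⟩
    refine ⟨fun i hi => by simp [h i hi], ?_⟩
    simp only [Pi.smul_apply, smul_eq_mul, mul_left_comm _ r, ← Finset.mul_sum, hs, mul_zero]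

theorem edgeVec_mem_balancedChanges (hcol : E.ColumnStochastic)
    (hadv : E.Eavesdropping ∨ E.Collusion) (hweight : ∀ i ∉ E.corrupted, E.totalWeight i ≠ 0)
    {i : Fin n} {t : Fin T} (hun : E.Unseen i t.castSucc) :
    E.edgeVec i t ∈ E.balancedChanges := by
  obtain ⟨hi, hun⟩ := hun
  have hobs := hun _ le_rfl fun r h h' => absurd h' (not_le.2 h)
  refine ⟨fun j hj => by simp [edgeVec, hj], ?_⟩
  have h1 : ∀ j ∈ E.corruptedᶜ, E.totalWeight j * E.edgeVec i t j =
      E.weightOn t j i - if j = i then 1 else 0 := fun j hj => by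
    rw [Finset.mem_compl] at hj
    by_cases h : j = i
    · subst h
      simp [edgeVec, hj, mul_div_cancel₀ _ (hweight j hj)]
    · simp [edgeVec, hj, h, mul_div_cancel₀ _ (hweight j hj)]
  rw [Finset.sum_congr rfl h1, Finset.sum_sub_distrib, Finset.sum_ite_eq',
    if_pos (Finset.mem_compl.2 hi), sub_eq_zero, ← hcol.sum_weightOn t i]
  exact Finset.sum_subset (Finset.subset_univ _) fun j _ hj =>
    weightOn_eq_zero_of_unobserved hadv (by simpa using hj) hi hobs

theorem finrank_balancedChanges_add_one_le (hhonest : E.numHonest ≠ 0)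
    (hweight : ∀ i ∉ E.corrupted, E.totalWeight i ≠ 0) :
    Module.finrank ℝ E.balancedChanges + 1 ≤ E.numHonest := by
  let φ : Module.Dual ℝ ({i // i ∈ E.corruptedᶜ} → ℝ) :=
    ∑ i : {i // i ∈ E.corruptedᶜ}, E.totalWeight i • LinearMap.proj i
  have hφa : ∀ a : {i // i ∈ E.corruptedᶜ} → ℝ,
      φ a = ∑ i : {i // i ∈ E.corruptedᶜ}, E.totalWeight i * a i := fun a => by
    simp [φ, LinearMap.sum_apply]
  have hφ : φ ≠ 0 := by
    obtain ⟨i, hi⟩ := Finset.card_ne_zero.1 hhonest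
    intro h0
    have := hφa (Pi.single ⟨i, hi⟩ 1)
    rw [h0] at this
    simp only [Pi.single_apply, LinearMap.zero_apply, mul_ite, mul_one, mul_zero,
      Finset.sum_ite_eq', Finset.mem_univ, if_true] at this
    exact hweight i (Finset.mem_compl.1 hi) this.symm
  let ρ : (Fin n → ℝ) →ₗ[ℝ] ({i // i ∈ E.corruptedᶜ} → ℝ) :=
    LinearMap.pi fun i => LinearMap.proj i.1
  have hker := Module.Dual.finrank_ker_add_one_of_ne_zero hφ
  rw [Module.finrank_fintype_fun_eq_card, Fintype.card_coe] at hker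
  change _ = E.numHonest at hker
  rw [← hker]
  gcongr
  let ψ : E.balancedChanges →ₗ[ℝ] LinearMap.ker φ :=
    (ρ.comp E.balancedChanges.subtype).codRestrict _ fun a => by
      rw [LinearMap.mem_ker, hφa, ← a.2.2]
      exact Finset.sum_coe_sort E.corruptedᶜ fun i => E.totalWeight i * a.1 i
  refine LinearMap.finrank_le_finrank_of_injective (f := ψ) fun a b hab => ?_
  ext i
  by_cases hi : i ∈ E.corrupted
  · rw [a.2.1 i hi, b.2.1 i hi]
  · exact congrFun (congrArg Subtype.val hab) ⟨i, Finset.mem_compl.2 hi⟩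

/-- By dimension, the vectors `e^(i,t)` span the balanced changes. -/
theorem balancedChanges_le_hiddenChanges (hZ : IsUnit (Matrix.of fun t k => E.Z t.castSucc k :
    Matrix (Fin T) (Fin T) ℝ)) (hcol : E.ColumnStochastic) (hadv : E.Eavesdropping ∨ E.Collusion)
    (hhonest : E.numHonest ≠ 0) (hweight : ∀ i ∉ E.corrupted, E.totalWeight i ≠ 0)
    (hindep : E.numHonest - 1 ≤ Module.finrank ℝ (Submodule.span ℝ E.edgeVecs)) :
    E.balancedChanges ≤ E.hiddenChanges := by
  have hle : Submodule.span ℝ E.edgeVecs ≤ E.balancedChanges :=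
    Submodule.span_le.2 fun _ ⟨_, _, hun, h⟩ =>
      h ▸ edgeVec_mem_balancedChanges hcol hadv hweight hun
  have hdim := finrank_balancedChanges_add_one_le hhonest hweight
  rw [← Submodule.eq_of_le_of_finrank_le hle (by omega)]
  exact Submodule.span_le.2 fun _ ⟨_, _, hun, h⟩ =>
    h ▸ edgeVec_mem_hiddenChanges hZ hadv hweight hun

end Execution
namespace Execution

variable {n T : ℕ} {E : Execution n T}

/-! ### The changes of the noise -/

/-- A unit of weight at `i₀` can be moved elsewhere at a cost that does not depend on `i₀`: if the
honest parties inject more than one unit, spread it evenly over the others, and leave it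
where it is otherwise. -/
theorem exists_balanced_shift (hhonest : 2 ≤ E.numHonest)
    (hweight : ∀ i ∉ E.corrupted, 0 < E.totalWeight i ∧ E.totalWeight i ≤ 1)
    (hne : E.honestWeight ≠ 1) {i₀ : Fin n} (hi₀ : i₀ ∉ E.corrupted) :
    ∃ τ : Fin n → ℝ, (∀ i ∈ E.corrupted, τ i = 0) ∧
      τ - Pi.single i₀ 1 ∈ E.balancedChanges ∧
      ∑ i, τ i ^ 2 ≤ ((E.numHonest : ℝ) - 1) / (E.honestWeight - 1) ^ 2 := by
  have hmem : i₀ ∈ E.corruptedᶜ := Finset.mem_compl.2 hi₀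
  have hn : (2 : ℝ) ≤ E.numHonest := by exact_mod_cast hhonest
  obtain ⟨hw0, hw1⟩ := hweight i₀ hi₀
  have hsum : E.totalWeight i₀ + ∑ i ∈ E.corruptedᶜ.erase i₀, E.totalWeight i = E.honestWeight :=
    Finset.add_sum_erase _ _ hmem
  rcases lt_or_gt_of_ne hne with hlt | hgt
  · refine ⟨Pi.single i₀ 1, fun i hi => ?_, by rw [sub_self]; exact Submodule.zero_mem _, ?_⟩
    · exact Pi.single_eq_of_ne (fun h => hi₀ (by rwa [← h])) _
    · have hpos : 0 ≤ ∑ i ∈ E.corruptedᶜ.erase i₀, E.totalWeight i :=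
        Finset.sum_nonneg fun i hi =>
          (hweight i (by simpa using (Finset.mem_erase.1 hi).2)).1.le
      have h1 : ∑ i, (Pi.single i₀ 1 : Fin n → ℝ) i ^ 2 = 1 := by
        simp [Pi.single_apply, ite_pow]
      rw [h1, le_div_iff₀ (by nlinarith)]
      nlinarith
  · have hd : 0 < E.honestWeight - E.totalWeight i₀ := by linarith
    let b := E.totalWeight i₀ / (E.honestWeight - E.totalWeight i₀)
    let τ : Fin n → ℝ := fun i => if i ∈ E.corruptedᶜ.erase i₀ then b else 0
    refine ⟨τ, fun i hi => by simp [τ, hi], ⟨fun i hi => ?_, ?_⟩, ?_⟩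
    · have : i ≠ i₀ := fun h => hi₀ (by rwa [← h])
      simp [τ, hi, this]
    · rw [← Finset.add_sum_erase _ _ hmem]
      have h1 : ∀ i ∈ E.corruptedᶜ.erase i₀,
          E.totalWeight i * (τ - Pi.single i₀ 1 : Fin n → ℝ) i = E.totalWeight i * b :=
            fun i hi => by
        have : i ≠ i₀ := (Finset.mem_erase.1 hi).1
        simp only [Pi.sub_apply, τ, if_pos hi, Pi.single_eq_of_ne this, sub_zero]
      rw [Finset.sum_congr rfl h1, ← Finset.sum_mul, eq_sub_of_add_eq' hsum]
      simp only [Pi.sub_apply, Pi.single_eq_same, τ, Finset.notMem_erase, if_false, b]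
      rw [mul_div_cancel₀ _ hd.ne']
      ring
    · have h1 : ∑ i, τ i ^ 2 = (E.numHonest - 1 : ℝ) * b ^ 2 := by
        simp only [τ, ite_pow, ne_eq, OfNat.ofNat_ne_zero, not_false_eq_true, zero_pow]
        rw [Finset.sum_ite_mem, Finset.univ_inter, Finset.sum_const, nsmul_eq_mul,
          Finset.card_erase_of_mem hmem, Nat.cast_sub (Finset.card_pos.2 ⟨_, hmem⟩), Nat.cast_one]
        rfl
      rw [h1, div_eq_mul_inv]
      refine mul_le_mul_of_nonneg_left ?_ (by linarith)
      rw [← inv_pow]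
      refine pow_le_pow_left₀ (by positivity) ?_ 2
      rw [inv_eq_one_div, div_le_div_iff₀ hd (by linarith)]
      nlinarith

/-- By linearity, what hides a unit change of the value of `i₀` hides any change of that value
after scaling. -/
theorem Hides.of_hidden {x x' τ : Fin n → ℝ} {Δ : Fin n → Fin T → ℝ} {i₀ : Fin n}
    (hx : ∀ j, j ≠ i₀ → x j = x' j) (hτ : ∀ i ∈ E.corrupted, τ i = 0)
    (hΔ : ∀ i ∈ E.corrupted, Δ i = 0) (hv : E.view (τ - Pi.single i₀ 1) Δ = 0) :
    E.Hides x x' ((x i₀ - x' i₀) • τ) ((x i₀ - x' i₀) • Δ) := by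
  refine ⟨fun i hi => by simp [hτ i hi, hΔ i hi], fun η g => ?_⟩
  have hu : x' + η + (x i₀ - x' i₀) • τ =
      (x + η) + (x i₀ - x' i₀) • (τ - Pi.single i₀ 1) := by
    funext j
    by_cases hj : j = i₀
    · subst hj
      simp only [Pi.add_apply, Pi.smul_apply, Pi.sub_apply, Pi.single_eq_same, smul_eq_mul]
      ring
    · simp only [Pi.add_apply, Pi.smul_apply, Pi.sub_apply, Pi.single_eq_of_ne hj, smul_eq_mul,
        hx j hj]
      ring
  rw [hu, view_add, view_smul, hv, smul_zero, add_zero]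

theorem exists_hiding_change (hZ : IsUnit (Matrix.of fun t k => E.Z t.castSucc k :
    Matrix (Fin T) (Fin T) ℝ)) (hcol : E.ColumnStochastic)
    (hadv : E.Eavesdropping ∨ E.Collusion) (hhonest : 2 ≤ E.numHonest)
    (hweight : ∀ i ∉ E.corrupted, 0 < E.totalWeight i ∧ E.totalWeight i ≤ 1)
    (hne : E.honestWeight ≠ 1)
    (hindep : E.numHonest - 1 ≤ Module.finrank ℝ (Submodule.span ℝ E.edgeVecs)) :
    ∃ R : ℝ, ∀ x x', E.Neighboring x x' → ∃ (θ : Fin n → ℝ) (Δ : Fin n → Fin T → ℝ),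
      E.Hides x x' θ Δ ∧ ∑ i, ∑ k, Δ i k ^ 2 ≤ R ∧
      ∑ i, θ i ^ 2 ≤ ((E.numHonest : ℝ) - 1) / (E.honestWeight - 1) ^ 2 := by
  have hunit : ∀ i₀, ∃ (τ : Fin n → ℝ) (Δ : Fin n → Fin T → ℝ), i₀ ∉ E.corrupted →
      (∀ i ∈ E.corrupted, τ i = 0) ∧ (∀ i ∈ E.corrupted, Δ i = 0) ∧
      E.view (τ - Pi.single i₀ 1) Δ = 0 ∧
      ∑ i, τ i ^ 2 ≤ ((E.numHonest : ℝ) - 1) / (E.honestWeight - 1) ^ 2 := fun i₀ => by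
    by_cases hi₀ : i₀ ∈ E.corrupted
    · exact ⟨0, 0, fun h => absurd hi₀ h⟩
    · obtain ⟨τ, hτ, hbal, hle⟩ := exists_balanced_shift hhonest hweight hne hi₀
      obtain ⟨Δ, hΔ, hv⟩ := balancedChanges_le_hiddenChanges hZ hcol hadv (by omega)
        (fun i hi => (hweight i hi).1.ne') hindep hbal
      exact ⟨τ, Δ, fun _ => ⟨hτ, fun i hi => (hΔ i hi).2, hv, hle⟩⟩
  choose τ Δ h using hunit
  refine ⟨∑ i₀, ∑ i, ∑ k, Δ i₀ i k ^ 2, fun x x' ⟨hx, hx', i₀, hi₀, hxx'⟩ => ?_⟩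
  obtain ⟨hτ, hΔ, hv, hle⟩ := h i₀ hi₀
  have hα : (x i₀ - x' i₀) ^ 2 ≤ 1 := by
    have h1 := hx i₀
    have h2 := hx' i₀
    rw [Set.mem_Icc] at h1 h2
    rw [sq_le_one_iff_abs_le_one, abs_le]
    constructor <;> linarith
  refine ⟨_, _, Hides.of_hidden hxx' hτ hΔ hv, ?_, ?_⟩
  · simp only [Pi.smul_apply, smul_eq_mul, mul_pow, ← Finset.mul_sum]
    refine (mul_le_of_le_one_left (by positivity) hα).trans ?_
    exact Finset.single_le_sum (f := fun i₀ => ∑ i, ∑ k, Δ i₀ i k ^ 2)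
      (fun i _ => by positivity) (Finset.mem_univ i₀)
  · simp only [Pi.smul_apply, smul_eq_mul, mul_pow, ← Finset.mul_sum]
    exact (mul_le_of_le_one_left (by positivity) hα).trans hle

/-! ### From hiding to differential privacy -/

theorem Hides.collusionView_eq {x x' θ : Fin n → ℝ} {Δ : Fin n → Fin T → ℝ}
    (h : E.Hides x x' θ Δ) (ω : (Fin n → ℝ) × (Fin n → Fin T → ℝ)) :
    E.collusionView x ω = E.collusionView x' (ω + (θ, Δ)) := by
  refine Prod.ext ?_ (Prod.ext ?_ ?_)
  · simpa only [collusionView, Prod.fst_add, Prod.snd_add, add_assoc] using h.2 ω.1 ω.2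
  · funext i
    simp [collusionView, h.1 i i.2]
  · funext i
    simp [collusionView, h.1 i i.2]

end Execution

/-- An algorithm is private if a translation of its Gaussian noise of squared norm at most
`(ε / κ) ^ 2` compensates for any change between neighboring inputs. -/
theorem isDP_of_shift {X Y : Type*} [MeasurableSpace Y] {n T : ℕ} {neighboring : X → X → Prop}
    {ε δ κ : ℝ} {vInd vCan : ℝ≥0} (hε : 0 < ε) (hε1 : ε < 1) (hδ : 0 < δ) (hδ1 : δ < 1)
    (hκ : 2 * Real.log (1.25 / δ) < κ ^ 2) (hInd : vInd ≠ 0) (hCan : vCan ≠ 0)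
    {F : X → (Fin n → ℝ) × (Fin n → Fin T → ℝ) → Y} (hF : ∀ x, Measurable (F x))
    (h : ∀ x x', neighboring x x' → ∃ (θ : Fin n → ℝ) (Δ : Fin n → Fin T → ℝ),
      (∀ ω, F x ω = F x' (ω + (θ, Δ))) ∧
      (∑ i, θ i ^ 2) / vInd + (∑ i, ∑ k, Δ i k ^ 2) / vCan ≤ ε ^ 2 / κ ^ 2) :
    IsDP neighboring ε δ fun x => (noiseLaw n T vInd vCan).map (F x) := by
  intro x x' hxx' S hS
  obtain ⟨θ, Δ, hshift, hle⟩ := h x x' hxx'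
  obtain ⟨ℓ, q, hgs, hq⟩ := exists_isGaussianShift_noiseLaw hInd hCan θ Δ
  simp only [Measure.map_apply (hF _) hS]
  have hpre : F x ⁻¹' S = {ω | ω + (θ, Δ) ∈ F x' ⁻¹' S} := by
    ext ω
    simp only [Set.mem_preimage, Set.mem_ofPred_eq, hshift ω]
  rw [hpre]
  exact hgs.measure_le hε hε1 hδ hδ1 hκ (hq ▸ hle) (hF x' hS)

end IncA

theorem mainTheorem4 {n T : ℕ} (E : IncA.Execution n T)
    (hvalid : IncA.IsValidGaussian E.c E.Z)
    (hcol : E.ColumnStochastic)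
    (hadv : E.Eavesdropping ∨ E.Collusion)
    (hhonest : 2 ≤ E.numHonest)
    (hweight : ∀ i ∉ E.corrupted, 0 < E.totalWeight i ∧ E.totalWeight i ≤ 1)
    (hne : E.honestWeight ≠ 1)
    (hindep : E.numHonest - 1 ≤ Module.finrank ℝ (Submodule.span ℝ E.edgeVecs)) :
    ∃ (θ : (Fin n → ℝ) → (Fin n → ℝ) → Fin n → ℝ)
      (Δ : (Fin n → ℝ) → (Fin n → ℝ) → Fin n → Fin T → ℝ),
      (∀ x x', E.Neighboring x x' → E.Hides x x' (θ x x') (Δ x x')) ∧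
      (∃ R : ℝ, ∀ x x', E.Neighboring x x' → ∑ i, ∑ k, Δ x x' i k ^ 2 ≤ R) ∧
      ∀ (ε δ κ : ℝ) (vInd vCan : NNReal),
        0 < ε → ε < 1 → 0 < δ → δ < 1 →
        2 * Real.log (1.25 / δ) < κ ^ 2 →
        ((E.numHonest : ℝ) - 1) * κ ^ 2 / ((E.honestWeight - 1) ^ 2 * ε ^ 2) < vInd →
        0 < vCan →
        (∀ x x', E.Neighboring x x' →
          (∑ i, ∑ k, Δ x x' i k ^ 2) /
            (ε ^ 2 / κ ^ 2 - ((E.numHonest : ℝ) - 1) / ((E.honestWeight - 1) ^ 2 * vInd))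
            ≤ vCan) →
        (E.Eavesdropping → E.EavesdropDP ε δ vInd vCan) ∧
        (E.Collusion → E.CollusionDP ε δ vInd vCan) := by
  obtain ⟨R, hR⟩ := IncA.Execution.exists_hiding_change hvalid.isUnit_init hcol hadv hhonest
    hweight hne hindep
  have hchoice : ∀ x x', ∃ (θ : Fin n → ℝ) (Δ : Fin n → Fin T → ℝ), E.Neighboring x x' →
      E.Hides x x' θ Δ ∧ ∑ i, ∑ k, Δ i k ^ 2 ≤ R ∧
      ∑ i, θ i ^ 2 ≤ ((E.numHonest : ℝ) - 1) / (E.honestWeight - 1) ^ 2 := fun x x' => by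
    by_cases h : E.Neighboring x x'
    · obtain ⟨θ, Δ, h'⟩ := hR x x' h
      exact ⟨θ, Δ, fun _ => h'⟩
    · exact ⟨0, 0, fun h' => absurd h' h⟩
  choose θ Δ hθΔ using hchoice
  refine ⟨θ, Δ, fun x x' h => (hθΔ x x' h).1, ⟨R, fun x x' h => (hθΔ x x' h).2.1⟩, ?_⟩
  intro ε δ κ vInd vCan hε hε1 hδ hδ1 hκ hInd hCan hΔ
  have hn : (1 : ℝ) ≤ (E.numHonest : ℝ) - 1 := by
    have : (2 : ℝ) ≤ E.numHonest := by exact_mod_cast hhonest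
    linarith
  have hw : 0 < (E.honestWeight - 1) ^ 2 := by
    have := sub_ne_zero.2 hne
    positivity
  have hκ0 : 0 < κ ^ 2 := by
    have : 0 < Real.log (1.25 / δ) := Real.log_pos (by rw [lt_div_iff₀ hδ]; linarith)
    linarith
  have hInd0 : (0 : ℝ) < vInd := lt_of_le_of_lt (by positivity) hInd
  have hCan0 : (0 : ℝ) < vCan := by exact_mod_cast hCan
  have hbudget : 0 < ε ^ 2 / κ ^ 2 -
      ((E.numHonest : ℝ) - 1) / ((E.honestWeight - 1) ^ 2 * vInd) := by
    rw [div_lt_iff₀ (by positivity)] at hInd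
    rw [sub_pos, div_lt_div_iff₀ (by positivity) hκ0]
    linarith
  -- The independent noise and the canceling noise share the budget `(ε / κ) ^ 2`.
  have hnorm : ∀ x x', E.Neighboring x x' →
      (∑ i, θ x x' i ^ 2) / vInd + (∑ i, ∑ k, Δ x x' i k ^ 2) / vCan ≤ ε ^ 2 / κ ^ 2 :=
    fun x x' h => by
      have h1 : (∑ i, θ x x' i ^ 2) / vInd ≤
          ((E.numHonest : ℝ) - 1) / ((E.honestWeight - 1) ^ 2 * vInd) := by
        rw [← div_div]
        exact div_le_div_of_nonneg_right (hθΔ x x' h).2.2 hInd0.le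
      have h2 := (div_le_comm₀ hbudget hCan0).1 (hΔ x x' h)
      linarith
  refine ⟨fun _ => ?_, fun _ => ?_⟩
  · exact IncA.isDP_of_shift hε hε1 hδ hδ1 hκ (by exact_mod_cast hInd0.ne') hCan.ne'
      E.measurable_view fun x x' h => ⟨θ x x', Δ x x', fun ω => congrArg Prod.fst
        ((hθΔ x x' h).1.collusionView_eq ω), hnorm x x' h⟩
  · exact IncA.isDP_of_shift hε hε1 hδ hδ1 hκ (by exact_mod_cast hInd0.ne') hCan.ne'
      E.measurable_collusionView fun x x' h => ⟨θ x x', Δ x x',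
        (hθΔ x x' h).1.collusionView_eq, hnorm x x' h⟩
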